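/- Let $U$ be a unitary operator on a separable complex Hilbert space $H$ (inner product linear in the second variable), and let $\mathbb{T}$ be the unit circle. For $f\in C(\mathbb{T})$ let $f(U)$ be given by the continuous functional calculus of $U$. For $x\in H$ let $\mu_{x,x}$, the spectral measure of $U$ at $x$, be the unique finite Borel measure on $\mathbb{T}$ with $\int_{\mathbb{T}}f\,d\mu_{x,x}=\langle x,f(U)x\rangle$ for all $f\in C(\mathbb{T})$. (1) There exist a locally compact Hausdorff space $X$, a finite (regular) Borel measure $\nu$ on $X$, a continuous function $\varphi:X\to\mathbb{R}$, and a unitary map $\Theta:L^2(X,\nu)\to H$ such that $\Theta^{-1}U\Theta F=e^{i\varphi}F$ for all $F\in L^2(X,\nu)$. (2) Concretely, there are a set $A\subseteq\mathbb{N}$ (finite or infinite, possibly empty) and nonzero vectors $y_n\in H$ $(n\in A)$ such that $H$ is the orthogonal Hilbert sum of the closed cyclic subspaces $H_n=\overline{\{f(U)y_n: f\in C(\mathbb{T})\}}$; and, on $\mathbb{T}\times A$ (with $A$ discrete), there are a finite Borel measure $\nu$ which restricts to $\mu_{y_n,y_n}$ on each component $\mathbb{T}\times\{n\}$, a Borel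 function $\varphi:\mathbb{T}\times A\to\mathbb{R}$ with $e^{i\varphi(z,n)}=z$, and a unitary map $\Theta:L^2(\mathbb{T}\times A,\nu)\to H$ such that: - for $n\in A$ and $f\in C(\mathbb{T})$, $\Theta$ maps the function equal to $f$ on $\mathbb{T}\times\{n\}$ and to $0$ on the other components to $f(U)y_n$; - for all $F\in L^2(\mathbb{T}\times A,\nu)$, $\Theta^{-1}U\Theta F=e^{i\varphi}F$, that is, $(\Theta^{-1}U\Theta F)(z,n)=zF(z,n)$ for $\nu$-almost every $(z,n)$. -/

import Mathlib

open MeasureTheory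

noncomputable section

/-- The unit circle `𝕋` carries its Borel sigma-algebra. -/
instance instMeasurableSpaceUnitCircle : MeasurableSpace Circle := borel Circle

instance instBorelSpaceUnitCircle : BorelSpace Circle := ⟨rfl⟩

/-- The inclusion of the spectrum of a unitary operator in the unit circle, as a continuous map. -/
def spectrumToCircle {H : Type*} [NormedAddCommGroup H] [InnerProductSpace ℂ H] [CompleteSpace H]
    (U : unitary (H →L[ℂ] H)) : C(spectrum ℂ (U : H →L[ℂ] H), Circle) where
  toFun z := ⟨(z : ℂ), spectrum.subset_circle_of_unitary U.2 z.2⟩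
  continuous_toFun := by
    exact Continuous.subtype_mk continuous_subtype_val _

/-- The continuous calculus `f ↦ f(U)` of a unitary operator `U`, defined for `f ∈ C(𝕋)`:
restrict `f` to the spectrum of `U` and apply the continuous functional calculus. -/
def circleCalculus {H : Type*} [NormedAddCommGroup H] [InnerProductSpace ℂ H] [CompleteSpace H]
    (U : unitary (H →L[ℂ] H)) : C(Circle, ℂ) →⋆ₐ[ℂ] (H →L[ℂ] H) :=
  (cfcHom (R := ℂ) (p := IsStarNormal) (a := (U : H →L[ℂ] H)) inferInstance).comp
    (ContinuousMap.compStarAlgHom' ℂ ℂ (spectrumToCircle U))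

/-- The calculus maps the coordinate function `e^{it} ↦ e^{it}` to `U`. -/
theorem circleCalculus_coord {H : Type*} [NormedAddCommGroup H] [InnerProductSpace ℂ H]
    [CompleteSpace H] (U : unitary (H →L[ℂ] H)) :
    circleCalculus U ⟨fun z : Circle => (z : ℂ), continuous_subtype_val⟩ = (U : H →L[ℂ] H) :=
  cfcHom_id (R := ℂ) (p := IsStarNormal) (a := (U : H →L[ℂ] H)) inferInstance

/-- The calculus is contractive for the uniform norm on `C(𝕋)`. -/
theorem norm_circleCalculus_le {H : Type*} [NormedAddCommGroup H] [InnerProductSpace ℂ H]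
    [CompleteSpace H] (U : unitary (H →L[ℂ] H)) (f : C(Circle, ℂ)) :
    ‖circleCalculus U f‖ ≤ ‖f‖ :=
  NonUnitalStarAlgHom.norm_apply_le (circleCalculus U) f

/-- `μ` is the spectral measure `μ_{x,x}` of the unitary operator `U` at the vector `x`: the finite
Borel measure on `𝕋` with `∫ f dμ = ⟨x, f(U) x⟩` for all `f ∈ C(𝕋)`. -/
def IsSpectralMeasure {H : Type*} [NormedAddCommGroup H] [InnerProductSpace ℂ H] [CompleteSpace H]
    (U : unitary (H →L[ℂ] H)) (x : H) (μ : Measure Circle) : Prop :=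
  IsFiniteMeasure μ ∧ ∀ f : C(Circle, ℂ), ∫ z, f z ∂μ = inner ℂ x (circleCalculus U f x)

/-- The closed cyclic subspace generated by `y`: the closure of `{f(U) y : f ∈ C(𝕋)}`. -/
def cyclicSubspace {H : Type*} [NormedAddCommGroup H] [InnerProductSpace ℂ H] [CompleteSpace H]
    (U : unitary (H →L[ℂ] H)) (y : H) : Submodule ℂ H :=
  (LinearMap.range ((ContinuousLinearMap.apply ℂ H y).toLinearMap ∘ₗ
    (circleCalculus U).toAlgHom.toLinearMap)).topologicalClosure

/-- The function on `𝕋 × A` equal to `f` on the component `𝕋 × {n}` and to `0` elsewhere. -/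
def onComponent {A : Set ℕ} (n : A) (f : C(Circle, ℂ)) : Circle × A → ℂ :=
  fun p => if p.2 = n then f p.1 else 0

end

/-!
A maximal family of unit vectors with pairwise orthogonal closed cyclic subspaces, which exists by
Zorn's lemma, decomposes `H`: a unit vector orthogonal to all of them would enlarge the family. It
is orthonormal, hence countable, and rescaling its `n`-th member to norm `2⁻ⁿ` makes the total
mass `∑ ‖y n‖ ^ 2` of the spectral measures finite. The Riesz representation theorem provides
these measures, because `f ↦ ⟨y, f(U) y⟩` is positive: `⟨y, (f̄ f)(U) y⟩ = ‖f(U) y‖ ^ 2`. The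
assignment sending `f` on the component `𝕋 × {n}` to `f(U) (y n)` preserves inner products, since
`⟨f(U) y, g(U) y⟩ = ∫ f̄ g dμ`, and both its domain and its range span dense subspaces; so it
extends to a unitary map, which intertwines multiplication by `z` with `U` because
`U f(U) = (z f)(U)`. The phase `arg z` jumps at `-1`, but transporting the measure along the
measurable embedding `(z, n) ↦ (arg z, n)` turns it into the continuous first projection of `ℝ × A`.
-/

open scoped BoundedContinuousFunction ENNReal

section InnerProductSpace

variable {𝕜 E F ι : Type*} [RCLike 𝕜] [NormedAddCommGroup E] [InnerProductSpace 𝕜 E]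
  [NormedAddCommGroup F] [InnerProductSpace 𝕜 F]

theorem exists_linearIsometryEquiv_of_inner_eq [CompleteSpace E] [CompleteSpace F]
    {v : ι → E} {w : ι → F} (hvw : ∀ i j, inner 𝕜 (v i) (v j) = inner 𝕜 (w i) (w j))
    (hv : Dense (Submodule.span 𝕜 (Set.range v) : Set E))
    (hw : Dense (Submodule.span 𝕜 (Set.range w) : Set F)) :
    ∃ Θ : E ≃ₗᵢ[𝕜] F, ∀ i, Θ (v i) = w i := by
  rw [← Finsupp.range_linearCombination] at hv hw
  have hnorm (c : ι →₀ 𝕜) :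
      ‖Finsupp.linearCombination 𝕜 w (LinearEquiv.refl 𝕜 _ c)‖ =
        ‖Finsupp.linearCombination 𝕜 v c‖ := by
    simp only [LinearEquiv.refl_apply, norm_eq_sqrt_re_inner (𝕜 := 𝕜),
      Finsupp.linearCombination_apply, Finsupp.sum, sum_inner, inner_sum, inner_smul_left,
      inner_smul_right, hvw]
  refine ⟨(LinearEquiv.refl 𝕜 (ι →₀ 𝕜)).extendOfIsometry _ _ hv hw hnorm, fun i => ?_⟩
  simpa only [LinearEquiv.refl_apply, Finsupp.linearCombination_single, one_smul] using
    (LinearEquiv.refl 𝕜 (ι →₀ 𝕜)).extendOfIsometry_eq _ _ hv hw hnorm (Finsupp.single i 1)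

theorem countable_of_orthonormal [TopologicalSpace.SeparableSpace E] {v : ι → E}
    (hv : Orthonormal 𝕜 v) : Countable ι := by
  have hdist {i j : ι} (hij : i ≠ j) : 1 ≤ dist (v i) (v j) := by
    have hsq : ‖v i - v j‖ ^ 2 = 2 := by
      rw [norm_sub_sq (𝕜 := 𝕜), hv.2 hij, hv.1, hv.1]
      norm_num
    rw [dist_eq_norm]
    nlinarith [norm_nonneg (v i - v j)]
  refine Pairwise.countable_of_isOpen_disjoint (s := fun i => Metric.ball (v i) (1 / 2))
    (fun i j hij => Metric.ball_disjoint_ball ?_) (fun _ => Metric.isOpen_ball)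
    fun i => ⟨v i, Metric.mem_ball_self one_half_pos⟩
  linarith [hdist hij]

theorem topologicalClosure_iSup_eq_top_of_isHilbertSum [CompleteSpace E] {K : ι → Submodule 𝕜 E}
    [∀ i, CompleteSpace (K i)] (hK : IsHilbertSum 𝕜 (fun i => K i) fun i => (K i).subtypeₗᵢ) :
    (⨆ i, K i).topologicalClosure = ⊤ := by
  have hrange := hK.OrthogonalFamily.range_linearIsometry
  rw [LinearMap.range_eq_top.2 hK.surjective_isometry] at hrange
  simpa only [Submodule.subtypeₗᵢ_toLinearMap, Submodule.range_subtype] using hrange.symm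

end InnerProductSpace

section PositiveFunctional

variable {X : Type*} [TopologicalSpace X] [CompactSpace X] [T2Space X] [MeasurableSpace X]
  [BorelSpace X]

theorem exists_regular_measure_integral_eq (Λ : C(X, ℝ) →ₚ[ℝ] ℝ) :
    ∃ μ : Measure X, IsFiniteMeasure μ ∧ μ.Regular ∧ ∀ f : C(X, ℝ), ∫ x, f x ∂μ = Λ f := by
  let Λc : CompactlySupportedContinuousMap X ℝ →ₚ[ℝ] ℝ :=
    { toFun := fun f => Λ f
      map_add' := fun f g => map_add Λ (f : C(X, ℝ)) g
      map_smul' := fun c f => map_smul Λ c (f : C(X, ℝ))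
      monotone' := fun _ _ h => OrderHomClass.mono Λ h }
  exact ⟨RealRMK.rieszMeasure Λc, ⟨isCompact_univ.measure_lt_top⟩, inferInstance, fun f =>
    RealRMK.integral_rieszMeasure Λc ⟨f, .of_compactSpace f⟩⟩

open scoped ComplexOrder in
theorem exists_regular_measure_integral_eq_of_nonneg {𝕜 : Type*} [RCLike 𝕜]
    (Λ : C(X, 𝕜) →ₗ[𝕜] 𝕜) (hΛ : ∀ g, 0 ≤ Λ (star g * g)) :
    ∃ μ : Measure X, IsFiniteMeasure μ ∧ μ.Regular ∧ ∀ f : C(X, 𝕜), ∫ x, f x ∂μ = Λ f := by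
  have hnonneg (f : C(X, ℝ)) (hf : 0 ≤ f) : 0 ≤ Λ (f.realToRCLike 𝕜) := by
    let g : C(X, ℝ) := ⟨fun x => √(f x), by fun_prop⟩
    have hfg : f = star g * g := by
      ext x
      exact (Real.mul_self_sqrt (hf x)).symm
    rw [hfg, ContinuousMap.realToRCLike_mul, ContinuousMap.realToRCLike_star]
    exact hΛ _
  let Λr : C(X, ℝ) →ₚ[ℝ] ℝ := .mk₀
    (RCLike.reLm ∘ₗ Λ.restrictScalars ℝ ∘ₗ
      (ContinuousMap.realToRCLikeStarAlgHom X 𝕜).toAlgHom.toLinearMap)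
    fun f hf => (RCLike.nonneg_iff.1 (hnonneg f hf)).1
  have him (f : C(X, ℝ)) : RCLike.im (Λ (f.realToRCLike 𝕜)) = 0 := by
    have hsub : f.realToRCLike 𝕜 = f⁺.realToRCLike 𝕜 - f⁻.realToRCLike 𝕜 := by
      conv_lhs => rw [← posPart_sub_negPart f]
      exact map_sub (ContinuousMap.realToRCLikeStarAlgHom X 𝕜) _ _
    rw [hsub, map_sub, map_sub, (RCLike.nonneg_iff.1 (hnonneg _ (posPart_nonneg f))).2,
      (RCLike.nonneg_iff.1 (hnonneg _ (negPart_nonneg f))).2, sub_zero]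
  obtain ⟨μ, hfin, hreg, hμ⟩ := exists_regular_measure_integral_eq Λr
  have hreal (f : C(X, ℝ)) : ((∫ x, f x ∂μ : ℝ) : 𝕜) = Λ (f.realToRCLike 𝕜) := by
    rw [hμ]
    exact RCLike.ext (RCLike.ofReal_re _) ((RCLike.ofReal_im _).trans (him f).symm)
  refine ⟨μ, hfin, hreg, fun f => ?_⟩
  let fre : C(X, ℝ) := f.rclikeToReal
  let fim : C(X, ℝ) := ⟨fun x => RCLike.im (f x), by fun_prop⟩
  have hf : f = fre.realToRCLike 𝕜 + (RCLike.I : 𝕜) • fim.realToRCLike 𝕜 := by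
    ext x
    exact (RCLike.re_add_im_ax (f x)).symm.trans (by simp [fre, fim, mul_comm])
  calc ∫ x, f x ∂μ = (∫ x, fre x ∂μ : ℝ) + (∫ x, fim x ∂μ : ℝ) * (RCLike.I : 𝕜) :=
        (integral_re_add_im
          (f.continuous.integrable_of_hasCompactSupport (.of_compactSpace f))).symm
    _ = Λ (fre.realToRCLike 𝕜) + RCLike.I * Λ (fim.realToRCLike 𝕜) := by
        rw [hreal, hreal, mul_comm]
    _ = Λ f := by rw [← smul_eq_mul, ← map_smul, ← map_add, ← hf]

end PositiveFunctional

section Lp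

variable {α β 𝕜 E : Type*} {mα : MeasurableSpace α} {mβ : MeasurableSpace β} [RCLike 𝕜]
  [NormedAddCommGroup E] [NormedSpace 𝕜 E] {p : ℝ≥0∞} [Fact (1 ≤ p)]

section MulBounded

variable [TopologicalSpace α] [BorelSpace α] [SecondCountableTopologyEither α 𝕜]

/-- Multiplication by a bounded continuous function, as an operator on `Lᵖ`. -/
noncomputable def mulBounded (E : Type*) [NormedAddCommGroup E] [NormedSpace 𝕜 E] (p : ℝ≥0∞)
    [Fact (1 ≤ p)] (μ : Measure α) (g : α →ᵇ 𝕜) : Lp E p μ →L[𝕜] Lp E p μ :=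
  (ContinuousLinearMap.lsmul 𝕜 𝕜).holderL μ ∞ p p (g.memLp_top.toLp g)

theorem coeFn_mulBounded (μ : Measure α) (g : α →ᵇ 𝕜) (F : Lp E p μ) :
    mulBounded E p μ g F =ᵐ[μ] fun x => g x • F x := by
  filter_upwards [(ContinuousLinearMap.lsmul 𝕜 𝕜).coeFn_holder (r := p) (g.memLp_top.toLp g) F,
    g.memLp_top.coeFn_toLp (μ := μ)] with x hmul hg
  rw [← hg]
  exact hmul

theorem mulBounded_toLp (μ : Measure α) [IsFiniteMeasure μ] (g h : α →ᵇ 𝕜) :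
    mulBounded 𝕜 p μ g (h.toLp p μ 𝕜) = (g * h).toLp p μ 𝕜 := by
  refine Lp.ext ?_
  filter_upwards [coeFn_mulBounded μ g (h.toLp p μ 𝕜), h.coeFn_toLp p μ 𝕜,
    (g * h).coeFn_toLp p μ 𝕜] with x hmul hh hgh
  rw [hmul, hh, hgh, smul_eq_mul, BoundedContinuousFunction.mul_apply]

end MulBounded

section MapMeasurableEmbedding

variable (𝕜 E p) {s : α → β} (hs : MeasurableEmbedding s) (μ : Measure α)

/-- Composition with a measurable embedding `s` identifies `Lᵖ` of the image measure with `Lᵖ`. -/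
noncomputable def lpMapEquiv : Lp E p (μ.map s) ≃ₗᵢ[𝕜] Lp E p μ :=
  .ofSurjective (Lp.compMeasurePreservingₗᵢ 𝕜 s (hs.measurable.measurePreserving μ)) fun F => by
    have hext : Function.extend s F 0 ∘ s = F := funext (hs.injective.extend_apply F 0)
    have hmem : MemLp (Function.extend s F 0) p (μ.map s) :=
      hs.memLp_map_measure_iff.2 (by rw [hext]; exact Lp.memLp F)
    refine ⟨hmem.toLp _, Lp.ext <| (Lp.coeFn_compMeasurePreserving _ _).trans ?_⟩
    filter_upwards [hs.ae_map_iff.1 hmem.coeFn_toLp] with x hx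
    exact hx.trans (congrFun hext x)

variable {𝕜 E p}

theorem coeFn_lpMapEquiv (F : Lp E p (μ.map s)) : lpMapEquiv 𝕜 E p hs μ F =ᵐ[μ] F ∘ s :=
  Lp.coeFn_compMeasurePreserving F (hs.measurable.measurePreserving μ)

theorem lpMapEquiv_symm_ae_eq_iff (F : Lp E p μ) (G : β → E) :
    (lpMapEquiv 𝕜 E p hs μ).symm F =ᵐ[μ.map s] G ↔ F =ᵐ[μ] G ∘ s := by
  have hF := coeFn_lpMapEquiv (𝕜 := 𝕜) hs μ ((lpMapEquiv 𝕜 E p hs μ).symm F)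
  rw [LinearIsometryEquiv.apply_symm_apply] at hF
  rw [Filter.EventuallyEq, hs.ae_map_iff]
  exact ⟨fun h => hF.trans h, fun h => hF.symm.trans h⟩

end MapMeasurableEmbedding

end Lp

section CyclicDecomposition

variable {𝕜 𝓐 H : Type*} [RCLike 𝕜] [Semiring 𝓐] [Algebra 𝕜 𝓐] [Star 𝓐] [NormedAddCommGroup H]
  [InnerProductSpace 𝕜 H] [CompleteSpace H]

theorem inner_map_map (π : 𝓐 →⋆ₐ[𝕜] (H →L[𝕜] H)) (a b : 𝓐) (x y : H) :
    inner 𝕜 (π a x) (π b y) = inner 𝕜 x (π (star a * b) y) := by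
  rw [map_mul, map_star, ContinuousLinearMap.star_eq_adjoint, mul_apply_eq_comp,
    ContinuousLinearMap.adjoint_inner_right]

/-- The closed cyclic subspace `closure {π a y | a ∈ 𝓐}` generated by `y` under a representation
`π` of a star algebra. For `π = circleCalculus U` it is definitionally `cyclicSubspace U y`. -/
noncomputable def orbitClosure (π : 𝓐 →⋆ₐ[𝕜] (H →L[𝕜] H)) (y : H) : Submodule 𝕜 H :=
  (LinearMap.range ((ContinuousLinearMap.apply 𝕜 H y).toLinearMap ∘ₗ
    π.toAlgHom.toLinearMap)).topologicalClosure

variable {π : 𝓐 →⋆ₐ[𝕜] (H →L[𝕜] H)} {y z : H} {S : Set H}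

instance completeSpace_orbitClosure : CompleteSpace (orbitClosure π y) :=
  (Submodule.isClosed_topologicalClosure _).completeSpace_coe

theorem map_mem_orbitClosure (a : 𝓐) : π a y ∈ orbitClosure π y :=
  Submodule.le_topologicalClosure _ ⟨a, rfl⟩

theorem self_mem_orbitClosure : y ∈ orbitClosure π y := by
  simpa only [map_one, one_apply_eq_self] using map_mem_orbitClosure (π := π) 1

theorem orbitClosure_le {K : Submodule 𝕜 H} (hK : IsClosed (K : Set H)) (h : ∀ a, π a y ∈ K) :
    orbitClosure π y ≤ K := by
  refine Submodule.topologicalClosure_minimal _ ?_ hK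
  rintro _ ⟨a, rfl⟩
  exact h a

theorem orbitClosure_smul {c : 𝕜} (hc : c ≠ 0) : orbitClosure π (c • y) = orbitClosure π y := by
  refine le_antisymm ?_ ?_ <;>
    refine orbitClosure_le (Submodule.isClosed_topologicalClosure _) fun a => ?_
  · rw [map_smul]
    exact Submodule.smul_mem _ _ (map_mem_orbitClosure a)
  · have h := map_mem_orbitClosure (π := π) (y := c • y) (c⁻¹ • a)
    rwa [map_smul, map_smul, smul_apply, smul_inv_smul₀ hc] at h

theorem isOrtho_orbitClosure (h : ∀ a, inner 𝕜 y (π a z) = 0) :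
    orbitClosure π y ⟂ orbitClosure π z := by
  refine orbitClosure_le (Submodule.isClosed_orthogonal _) fun a => ?_
  rw [Submodule.mem_orthogonal']
  suffices orbitClosure π z ≤ (𝕜 ∙ π a y)ᗮ from fun w hw =>
    Submodule.mem_orthogonal_singleton_iff_inner_right.1 (this hw)
  refine orbitClosure_le (Submodule.isClosed_orthogonal _) fun b => ?_
  rw [Submodule.mem_orthogonal_singleton_iff_inner_right, inner_map_map]
  exact h _

/-- A set of unit vectors whose closed cyclic subspaces are pairwise orthogonal. -/
def IsCyclicFamily (π : 𝓐 →⋆ₐ[𝕜] (H →L[𝕜] H)) (S : Set H) : Prop :=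
  (∀ v ∈ S, ‖v‖ = 1) ∧ S.Pairwise fun v w => orbitClosure π v ⟂ orbitClosure π w

theorem IsCyclicFamily.orthonormal (hS : IsCyclicFamily π S) :
    Orthonormal 𝕜 ((↑) : S → H) :=
  ⟨fun v => hS.1 v v.2, fun v w hvw => (hS.2 v.2 w.2 (Subtype.coe_ne_coe.2 hvw)).inner_eq
    self_mem_orbitClosure self_mem_orbitClosure⟩

theorem IsCyclicFamily.insert (hS : IsCyclicFamily π S) (hy : ‖y‖ = 1)
    (h : y ∈ (⨆ v : S, orbitClosure π (v : H))ᗮ) : IsCyclicFamily π (insert y S) := by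
  have hortho (v : H) (hv : v ∈ S) : orbitClosure π y ⟂ orbitClosure π v :=
    isOrtho_orbitClosure fun a => (Submodule.mem_orthogonal' _ _).1 h _ <|
      le_iSup (fun v : S => orbitClosure π (v : H)) ⟨v, hv⟩ (map_mem_orbitClosure a)
  exact ⟨Set.forall_mem_insert.2 ⟨hy, hS.1⟩, Set.pairwise_insert.2 ⟨hS.2, fun v hv _ =>
    ⟨hortho v hv, (hortho v hv).symm⟩⟩⟩

theorem exists_maximal_isCyclicFamily (π : 𝓐 →⋆ₐ[𝕜] (H →L[𝕜] H)) :
    ∃ S : Set H, Maximal (IsCyclicFamily π) S := by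
  refine zorn_subset {S | IsCyclicFamily π S} fun c hc hchain => ⟨⋃₀ c, ⟨?_, ?_⟩, fun s hs =>
    Set.subset_sUnion_of_mem hs⟩
  · rintro v ⟨s, hs, hv⟩
    exact (hc hs).1 v hv
  · exact (Set.pairwise_sUnion hchain.directedOn).2 fun s hs => (hc hs).2

theorem isHilbertSum_of_maximal_isCyclicFamily (hS : Maximal (IsCyclicFamily π) S) :
    IsHilbertSum 𝕜 (fun v : S => orbitClosure π (v : H))
      fun v => (orbitClosure π (v : H)).subtypeₗᵢ := by
  refine .mkInternal _ (.of_pairwise fun v w hvw => hS.1.2 v.2 w.2 (Subtype.coe_ne_coe.2 hvw)) ?_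
  rw [top_le_iff, Submodule.topologicalClosure_eq_top_iff, Submodule.eq_bot_iff]
  intro w hw
  by_contra hw0
  have hunit : ‖((‖w‖⁻¹ : ℝ) : 𝕜) • w‖ = 1 := by
    rw [norm_smul, RCLike.norm_ofReal, abs_inv, abs_norm, inv_mul_cancel₀ (norm_ne_zero_iff.2 hw0)]
  have hu := Submodule.smul_mem _ ((‖w‖⁻¹ : ℝ) : 𝕜) hw
  set u : H := ((‖w‖⁻¹ : ℝ) : 𝕜) • w
  have huS : u ∈ S :=
    hS.2 (hS.1.insert hunit hu) (Set.subset_insert u S) (Set.mem_insert u S)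
  have hu0 : inner 𝕜 u u = 0 := (Submodule.mem_orthogonal' _ _).1 hu u <|
    le_iSup (fun v : S => orbitClosure π (v : H)) ⟨u, huS⟩ self_mem_orbitClosure
  rw [inner_self_eq_zero.1 hu0, norm_zero] at hunit
  exact zero_ne_one hunit

theorem exists_isHilbertSum_orbitClosure [TopologicalSpace.SeparableSpace H]
    (π : 𝓐 →⋆ₐ[𝕜] (H →L[𝕜] H)) {r : ℕ → ℝ} (hr : ∀ n, 0 < r n) :
    ∃ (A : Set ℕ) (y : A → H), (∀ n, ‖y n‖ = r n) ∧
      IsHilbertSum 𝕜 (fun n => orbitClosure π (y n)) fun n => (orbitClosure π (y n)).subtypeₗᵢ := by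
  obtain ⟨S, hS⟩ := exists_maximal_isCyclicFamily π
  have : Countable S := countable_of_orthonormal hS.1.orthonormal
  obtain ⟨e, he⟩ := exists_injective_nat S
  let E : S ≃ Set.range e := Equiv.ofInjective e he
  let y (n : Set.range e) : H := (r n : 𝕜) • (E.symm n : H)
  have hy (n : Set.range e) : orbitClosure π (y n) = orbitClosure π (E.symm n : H) :=
    orbitClosure_smul (RCLike.ofReal_ne_zero.2 (hr n).ne')
  have hsum := isHilbertSum_of_maximal_isCyclicFamily hS
  refine ⟨Set.range e, y, fun n => ?_, .mkInternal _ (.of_pairwise fun n m hnm => ?_) ?_⟩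
  · rw [norm_smul, RCLike.norm_ofReal, hS.1.1 _ (E.symm n).2, abs_of_pos (hr n), mul_one]
  · simp only [hy]
    exact hsum.OrthogonalFamily.isOrtho (E.symm.injective.ne hnm)
  · simp only [hy]
    rw [E.symm.iSup_comp (g := fun v : S => orbitClosure π (v : H)),
      topologicalClosure_iSup_eq_top_of_isHilbertSum hsum]

theorem dense_span_map_of_isHilbertSum {ι : Type*} {y : ι → H}
    (hy : IsHilbertSum 𝕜 (fun i => orbitClosure π (y i))
      fun i => (orbitClosure π (y i)).subtypeₗᵢ) :
    Dense (Submodule.span 𝕜 (Set.range fun q : ι × 𝓐 => π q.2 (y q.1)) : Set H) := by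
  rw [Submodule.dense_iff_topologicalClosure_eq_top, ← top_le_iff,
    ← topologicalClosure_iSup_eq_top_of_isHilbertSum hy]
  refine Submodule.topologicalClosure_minimal _ (iSup_le fun i => ?_)
    (Submodule.isClosed_topologicalClosure _)
  exact orbitClosure_le (Submodule.isClosed_topologicalClosure _) fun a =>
    Submodule.le_topologicalClosure _ (Submodule.subset_span ⟨(i, a), rfl⟩)

end CyclicDecomposition

section SpectralMeasure

variable {𝕜 X H : Type*} [RCLike 𝕜] [TopologicalSpace X] [MeasurableSpace X]
  [NormedAddCommGroup H] [InnerProductSpace 𝕜 H] [CompleteSpace H]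

/-- `μ` is the spectral measure at `x` of the representation `π` of `C(X, 𝕜)`, for compact `X`: a
finite measure with `∫ f dμ = ⟨x, π f x⟩` for all `f`. For `π = circleCalculus U` it is
definitionally `IsSpectralMeasure U x μ`. -/
def IsSpectralMeasureAt (π : C(X, 𝕜) →⋆ₐ[𝕜] (H →L[𝕜] H)) (x : H) (μ : Measure X) : Prop :=
  IsFiniteMeasure μ ∧ ∀ f : C(X, 𝕜), ∫ z, f z ∂μ = inner 𝕜 x (π f x)

open scoped ComplexOrder in
theorem exists_regular_isSpectralMeasureAt [CompactSpace X] [T2Space X] [BorelSpace X]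
    (π : C(X, 𝕜) →⋆ₐ[𝕜] (H →L[𝕜] H)) (x : H) :
    ∃ μ : Measure X, μ.Regular ∧ IsSpectralMeasureAt π x μ := by
  let Λ : C(X, 𝕜) →ₗ[𝕜] 𝕜 :=
    (innerSL 𝕜 x).toLinearMap ∘ₗ (ContinuousLinearMap.apply 𝕜 H x).toLinearMap ∘ₗ
      π.toAlgHom.toLinearMap
  have hΛ (g : C(X, 𝕜)) : 0 ≤ Λ (star g * g) :=
    calc (0 : 𝕜) ≤ (‖π g x‖ ^ 2 : ℝ) := RCLike.ofReal_nonneg.2 (sq_nonneg _)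
      _ = inner 𝕜 (π g x) (π g x) := by rw [inner_self_eq_norm_sq_to_K, RCLike.ofReal_pow]
      _ = Λ (star g * g) := inner_map_map π g g x x
  obtain ⟨μ, hfin, hreg, hμ⟩ := exists_regular_measure_integral_eq_of_nonneg Λ hΛ
  exact ⟨μ, hreg, hfin, hμ⟩

variable {π : C(X, 𝕜) →⋆ₐ[𝕜] (H →L[𝕜] H)} {x : H} {μ : Measure X}

theorem IsSpectralMeasureAt.measure_univ (h : IsSpectralMeasureAt π x μ) :
    μ Set.univ = ENNReal.ofReal (‖x‖ ^ 2) := by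
  have := h.1
  have hreal : (μ.real Set.univ : 𝕜) = (‖x‖ ^ 2 : ℝ) := by
    simpa only [ContinuousMap.one_apply, integral_const, map_one, one_apply_eq_self,
      inner_self_eq_norm_sq_to_K, ← RCLike.ofReal_pow, RCLike.real_smul_eq_coe_mul, mul_one]
      using h.2 1
  rw [← RCLike.ofReal_inj.1 hreal, ofReal_measureReal]

end SpectralMeasure

section Components

variable {𝕜 X ι : Type*} [RCLike 𝕜] [TopologicalSpace X] [CompactSpace X]
  [TopologicalSpace ι]

/-- The function `(x, i) ↦ f x` on `X × ι`. -/
noncomputable def liftFst (ι : Type*) [TopologicalSpace ι] (f : C(X, 𝕜)) : (X × ι) →ᵇ 𝕜 :=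
  (BoundedContinuousFunction.mkOfCompact f).compContinuous ContinuousMap.fst

variable [DiscreteTopology ι]

/-- The function on `X × ι` equal to `f` on the component `X × {i}` and to `0` elsewhere. -/
noncomputable def componentFun (i : ι) (f : C(X, 𝕜)) : (X × ι) →ᵇ 𝕜 :=
  .ofNormedAddCommGroup ((Prod.snd ⁻¹' {i}).indicator (f ∘ Prod.fst))
    (((isClopen_discrete {i}).preimage continuous_snd).continuous_indicator
      (f.continuous.comp continuous_fst))
    ‖f‖ fun p => (norm_indicator_le_norm_self _ _).trans (f.norm_coe_le_norm p.1)

theorem componentFun_of_eq {i : ι} (f : C(X, 𝕜)) {p : X × ι} (hp : p.2 = i) :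
    componentFun i f p = f p.1 :=
  Set.indicator_of_mem (s := Prod.snd ⁻¹' {i}) hp _

theorem componentFun_of_ne {i : ι} (f : C(X, 𝕜)) {p : X × ι} (hp : p.2 ≠ i) :
    componentFun i f p = 0 :=
  Set.indicator_of_notMem (s := Prod.snd ⁻¹' {i}) hp _

theorem liftFst_mul_componentFun (i : ι) (f g : C(X, 𝕜)) :
    liftFst ι f * componentFun i g = componentFun i (f * g) := by
  ext p
  by_cases hp : p.2 = i
  · rw [componentFun_of_eq _ hp]
    exact congrArg (f p.1 * ·) (componentFun_of_eq g hp)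
  · rw [componentFun_of_ne _ hp]
    exact mul_eq_zero_of_right _ (componentFun_of_ne g hp)

theorem eq_sum_componentFun (g : (X × ι) →ᵇ 𝕜) {s : Finset ι} (hs : ∀ p, g p ≠ 0 → p.2 ∈ s) :
    g = ∑ i ∈ s, componentFun i ⟨fun x => g (x, i), by fun_prop⟩ := by
  ext p
  rw [BoundedContinuousFunction.sum_apply]
  by_cases hp : p.2 ∈ s
  · exact .symm <| (Finset.sum_eq_single_of_mem p.2 hp fun _ _ hi =>
      componentFun_of_ne _ hi.symm).trans (componentFun_of_eq _ rfl)
  · exact (not_not.1 (mt (hs p) hp)).trans <| .symm <| Finset.sum_eq_zero fun _ hi =>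
      componentFun_of_ne _ (ne_of_mem_of_not_mem hi hp).symm

variable [MeasurableSpace X] [MeasurableSpace ι] [MeasurableSingletonClass ι]

theorem integral_componentFun (ν : Measure (X × ι)) (i : ι) (f : C(X, 𝕜)) :
    ∫ p, componentFun i f p ∂ν = ∫ x, f x ∂ν.comap (·, i) := by
  have hi : MeasurableEmbedding fun x : X => (x, i) := measurableEmbedding_prod_mk_right i
  have hrange : Prod.snd ⁻¹' {i} = Set.range fun x : X => (x, i) := by
    ext ⟨x, j⟩
    simp [eq_comm]
  calc ∫ p, componentFun i f p ∂ν = ∫ p in Set.range fun x : X => (x, i), f p.1 ∂ν := by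
        rw [← hrange]
        exact integral_indicator (hrange ▸ hi.measurableSet_range)
    _ = ∫ x, f x ∂ν.comap (·, i) := by rw [← hi.map_comap, hi.integral_map]

variable [BorelSpace X] [Countable ι]

theorem inner_toLp_componentFun_self (ν : Measure (X × ι)) [IsFiniteMeasure ν] (i : ι)
    (f g : C(X, 𝕜)) :
    inner 𝕜 ((componentFun i f).toLp 2 ν 𝕜) ((componentFun i g).toLp 2 ν 𝕜) =
      ∫ x, (star f * g) x ∂ν.comap (·, i) := by
  rw [BoundedContinuousFunction.inner_toLp, ← integral_componentFun]
  refine integral_congr_ae (.of_forall fun p => ?_)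
  by_cases hp : p.2 = i
  · simp only [componentFun_of_eq _ hp, ContinuousMap.mul_apply, ContinuousMap.star_apply, mul_comm,
      starRingEnd_apply]
  · simp only [componentFun_of_ne _ hp, zero_mul]

theorem inner_toLp_componentFun_of_ne (ν : Measure (X × ι)) [IsFiniteMeasure ν] {i j : ι}
    (hij : i ≠ j) (f g : C(X, 𝕜)) :
    inner 𝕜 ((componentFun i f).toLp 2 ν 𝕜) ((componentFun j g).toLp 2 ν 𝕜) = 0 := by
  rw [BoundedContinuousFunction.inner_toLp]
  refine integral_eq_zero_of_ae (.of_forall fun p => ?_)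
  by_cases hp : p.2 = i
  · exact mul_eq_zero_of_left (componentFun_of_ne g (hp ▸ hij)) _
  · simp only [componentFun_of_ne f hp, map_zero, mul_zero, Pi.zero_apply]

theorem dense_span_toLp_componentFun [T2Space X] {p : ℝ≥0∞} [Fact (1 ≤ p)] (hp : p ≠ ∞)
    (ν : Measure (X × ι)) [IsFiniteMeasure ν] [ν.Regular] :
    Dense (Submodule.span 𝕜 (Set.range fun i : ι × C(X, 𝕜) =>
      (componentFun i.1 i.2).toLp p ν 𝕜) : Set (Lp 𝕜 p ν)) := by
  intro F
  refine (mem_closure_iff_nhds_basis Metric.nhds_basis_closedEBall).2 fun ε hε => ?_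
  obtain ⟨g, hgsupp, hgε, hg, _⟩ :=
    (Lp.memLp F).exists_hasCompactSupport_eLpNorm_sub_le hp hε.ne'
  let G : (X × ι) →ᵇ 𝕜 := ofCompactSupport g hg hgsupp
  have hfin : (Prod.snd '' tsupport g).Finite :=
    (hgsupp.isCompact.image continuous_snd).finite_of_discrete
  have hsum := eq_sum_componentFun G (s := hfin.toFinset) fun q hq =>
    hfin.mem_toFinset.2 ⟨q, subset_tsupport g (Function.mem_support.2 hq), rfl⟩
  refine ⟨G.toLp p ν 𝕜, ?_, ?_⟩
  · rw [hsum, map_sum]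
    exact Submodule.sum_mem _ fun i _ => Submodule.subset_span ⟨(i, _), rfl⟩
  · rw [Metric.mem_closedEBall, edist_comm, Lp.edist_def]
    have hG : ⇑F - ⇑(G.toLp p ν 𝕜) =ᵐ[ν] ⇑F - g := .sub .rfl (G.coeFn_toLp p ν 𝕜)
    exact (eLpNorm_congr_ae hG).trans_le hgε

end Components

section ComponentSum

variable {X ι : Type*} [MeasurableSpace X] [MeasurableSpace ι]

/-- The measure on `X × ι` whose restriction to the component `X × {i}` is `μ i`. -/
noncomputable def componentSum (μ : ι → Measure X) : Measure (X × ι) :=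
  .sum fun i => (μ i).map (·, i)

theorem componentSum_univ (μ : ι → Measure X) :
    componentSum μ Set.univ = ∑' i, μ i Set.univ := by
  rw [componentSum, Measure.sum_apply _ .univ]
  exact tsum_congr fun i => by
    rw [Measure.map_apply measurable_prodMk_right .univ, Set.preimage_univ]

theorem comap_componentSum [MeasurableSingletonClass ι] (μ : ι → Measure X) (i : ι) :
    (componentSum μ).comap (·, i) = μ i := by
  have hι (j : ι) : MeasurableEmbedding fun x : X => (x, j) := measurableEmbedding_prod_mk_right j
  ext s hs
  rw [(hι i).comap_apply, componentSum, Measure.sum_apply _ ((hι i).measurableSet_image.2 hs),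
    tsum_eq_single i, (hι i).map_apply, Set.preimage_image_eq _ (hι i).injective]
  intro j hji
  have hempty : (fun x : X => (x, j)) ⁻¹' ((fun x => (x, i)) '' s) = ∅ := by
    ext x
    simp [hji.symm]
  rw [(hι j).map_apply, hempty, measure_empty]

end ComponentSum

section MultiplicationModel

variable {𝕜 X ι H : Type*} [RCLike 𝕜] [TopologicalSpace X] [CompactSpace X]
  [MeasurableSpace X] [BorelSpace X] [Countable ι] [TopologicalSpace ι] [DiscreteTopology ι]
  [MeasurableSpace ι] [MeasurableSingletonClass ι] [NormedAddCommGroup H] [InnerProductSpace 𝕜 H]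
  [CompleteSpace H] {π : C(X, 𝕜) →⋆ₐ[𝕜] (H →L[𝕜] H)} {y : ι → H} {ν : Measure (X × ι)}
  [IsFiniteMeasure ν]

theorem inner_toLp_componentFun_eq_inner_map
    (hy : OrthogonalFamily 𝕜 (fun i => orbitClosure π (y i))
      fun i => (orbitClosure π (y i)).subtypeₗᵢ)
    (hν : ∀ i, IsSpectralMeasureAt π (y i) (ν.comap (·, i))) (i j : ι) (f g : C(X, 𝕜)) :
    inner 𝕜 ((componentFun i f).toLp 2 ν 𝕜) ((componentFun j g).toLp 2 ν 𝕜) =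
      inner 𝕜 (π f (y i)) (π g (y j)) := by
  by_cases hij : i = j
  · subst hij
    rw [inner_toLp_componentFun_self, (hν i).2, inner_map_map]
  · rw [inner_toLp_componentFun_of_ne ν hij, (hy.isOrtho hij).inner_eq
      (map_mem_orbitClosure f) (map_mem_orbitClosure g)]

theorem exists_multiplication_model [T2Space X] [ν.Regular]
    (hy : IsHilbertSum 𝕜 (fun i => orbitClosure π (y i)) fun i => (orbitClosure π (y i)).subtypeₗᵢ)
    (hν : ∀ i, IsSpectralMeasureAt π (y i) (ν.comap (·, i))) :
    ∃ Θ : Lp 𝕜 2 ν ≃ₗᵢ[𝕜] H,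
      (∀ i f, Θ ((componentFun i f).toLp 2 ν 𝕜) = π f (y i)) ∧
      ∀ f F, π f (Θ F) = Θ (mulBounded 𝕜 2 ν (liftFst ι f) F) := by
  have hdense := dense_span_toLp_componentFun (𝕜 := 𝕜) (p := 2) ENNReal.ofNat_ne_top ν
  obtain ⟨Θ, hΘ⟩ := exists_linearIsometryEquiv_of_inner_eq
    (fun q r => inner_toLp_componentFun_eq_inner_map hy.OrthogonalFamily hν q.1 r.1 q.2 r.2)
    hdense (dense_span_map_of_isHilbertSum hy)
  have hΘ (i : ι) (f : C(X, 𝕜)) : Θ ((componentFun i f).toLp 2 ν 𝕜) = π f (y i) := hΘ (i, f)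
  refine ⟨Θ, hΘ, fun f F => ?_⟩
  suffices π f ∘L (Θ : Lp 𝕜 2 ν →L[𝕜] H) = (Θ : Lp 𝕜 2 ν →L[𝕜] H) ∘L
      mulBounded 𝕜 2 ν (liftFst ι f) from DFunLike.congr_fun this F
  refine ContinuousLinearMap.ext_on hdense ?_
  rintro _ ⟨⟨i, g⟩, rfl⟩
  calc π f (Θ ((componentFun i g).toLp 2 ν 𝕜)) = π (f * g) (y i) := by
        rw [hΘ, map_mul, mul_apply_eq_comp]
    _ = Θ (mulBounded 𝕜 2 ν (liftFst ι f) ((componentFun i g).toLp 2 ν 𝕜)) := by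
        rw [mulBounded_toLp, liftFst_mul_componentFun, hΘ]

end MultiplicationModel

theorem exists_isFiniteMeasure_comap_isSpectralMeasureAt {𝕜 X ι H : Type*} [RCLike 𝕜]
    [TopologicalSpace X] [CompactSpace X] [T2Space X] [MeasurableSpace X] [BorelSpace X]
    [MeasurableSpace ι] [MeasurableSingletonClass ι] [NormedAddCommGroup H]
    [InnerProductSpace 𝕜 H] [CompleteSpace H] (π : C(X, 𝕜) →⋆ₐ[𝕜] (H →L[𝕜] H)) {y : ι → H}
    (hy : Summable fun i => ‖y i‖ ^ 2) :
    ∃ ν : Measure (X × ι), IsFiniteMeasure ν ∧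
      ∀ i, IsSpectralMeasureAt π (y i) (ν.comap (·, i)) := by
  choose μ _ hμ using fun i => exists_regular_isSpectralMeasureAt π (y i)
  refine ⟨componentSum μ, ⟨?_⟩, fun i => ?_⟩
  · simp only [componentSum_univ, (hμ _).measure_univ]
    exact hy.tsum_ofReal_lt_top
  · rw [comap_componentSum]
    exact hμ i

theorem ae_eq_lpMapEquiv_trans {α β 𝕜 : Type*} {mα : MeasurableSpace α} {mβ : MeasurableSpace β}
    [RCLike 𝕜] {p : ℝ≥0∞} [Fact (1 ≤ p)] {s : α → β} (hs : MeasurableEmbedding s) {μ : Measure α}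
    {H : Type*} [NormedAddCommGroup H] [NormedSpace 𝕜 H] {Θ : Lp 𝕜 p μ ≃ₗᵢ[𝕜] H} {T : H → H}
    {g : β → 𝕜} (hΘ : ∀ F, Θ.symm (T (Θ F)) =ᵐ[μ] fun x => g (s x) * F x)
    (F : Lp 𝕜 p (μ.map s)) :
    ((lpMapEquiv 𝕜 𝕜 p hs μ).trans Θ).symm (T ((lpMapEquiv 𝕜 𝕜 p hs μ).trans Θ F))
      =ᵐ[μ.map s] fun x => g x * F x := by
  refine (lpMapEquiv_symm_ae_eq_iff hs μ _ _).2 ((hΘ _).trans ?_)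
  filter_upwards [coeFn_lpMapEquiv (𝕜 := 𝕜) hs μ F] with x hx
  exact congrArg (g (s x) * ·) hx

section Circle

theorem measurableEmbedding_arg_circle : MeasurableEmbedding fun z : Circle => Complex.arg z := by
  have hrange : Set.range (fun z : Circle => Complex.arg z) = Set.Ioc (-Real.pi) Real.pi := by
    rw [← Set.image_univ]
    exact Circle.argPartialEquiv.image_source_eq_target
  have hcoe : Continuous fun z : Circle => (z : ℂ) := by fun_prop
  exact .of_measurable_inverse (Complex.measurable_arg.comp hcoe.measurable)
    (hrange ▸ measurableSet_Ioc) Circle.exp.continuous.measurable Circle.exp_arg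

theorem exp_I_mul_arg_circle (z : Circle) :
    Complex.exp (Complex.I * (Complex.arg z : ℝ)) = z := by
  rw [mul_comm, ← Circle.coe_exp, Circle.exp_arg]

theorem onComponent_eq_componentFun {A : Set ℕ} (n : A) (f : C(Circle, ℂ)) :
    onComponent n f = componentFun n f := by
  ext p
  rw [onComponent]
  split_ifs with hp
  · exact (componentFun_of_eq f hp).symm
  · exact (componentFun_of_ne f hp).symm

theorem exists_toLp_onComponent_eq {A : Set ℕ} {p : ℝ≥0∞} [Fact (1 ≤ p)] (ν : Measure (Circle × A))
    [IsFiniteMeasure ν] (n : A) (f : C(Circle, ℂ)) :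
    ∃ hf : MemLp (onComponent n f) p ν,
      hf.toLp (onComponent n f) = (componentFun n f).toLp p ν ℂ := by
  have hae : componentFun n f |>.toLp p ν ℂ =ᵐ[ν] onComponent n f := by
    rw [onComponent_eq_componentFun]
    exact (componentFun n f).coeFn_toLp p ν ℂ
  have hf : MemLp (onComponent n f) p ν := (Lp.memLp _).ae_eq hae
  exact ⟨hf, Lp.ext (hf.coeFn_toLp.trans hae.symm)⟩

theorem ae_eq_exp_arg_mul {A : Set ℕ} {H : Type*} [NormedAddCommGroup H] [InnerProductSpace ℂ H]
    [CompleteSpace H] {U : unitary (H →L[ℂ] H)} {ν : Measure (Circle × A)}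
    {Θ : Lp ℂ 2 ν ≃ₗᵢ[ℂ] H}
    (hΘ : ∀ f F, circleCalculus U f (Θ F) = Θ (mulBounded ℂ 2 ν (liftFst A f) F)) (F : Lp ℂ 2 ν) :
    Θ.symm ((U : H →L[ℂ] H) (Θ F)) =ᵐ[ν]
      fun p => Complex.exp (Complex.I * (Complex.arg p.1 : ℝ)) * F p := by
  simp_rw [exp_I_mul_arg_circle]
  rw [← circleCalculus_coord U, hΘ, LinearIsometryEquiv.symm_apply_apply]
  exact coeFn_mulBounded ν _ F

end Circle

theorem mainTheorem4 {H : Type*} [NormedAddCommGroup H] [InnerProductSpace ℂ H] [CompleteSpace H]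
    [TopologicalSpace.SeparableSpace H] (U : unitary (H →L[ℂ] H)) :
    -- a model with a continuous phase
    (∃ (X : Type) (_ : TopologicalSpace X) (_ : LocallyCompactSpace X) (_ : T2Space X)
      (_ : MeasurableSpace X) (_ : BorelSpace X)
      (ν : Measure X) (_ : IsFiniteMeasure ν) (_ : ν.Regular)
      (φ : X → ℝ) (Θ : Lp ℂ 2 ν ≃ₗᵢ[ℂ] H),
      Continuous φ ∧
      ∀ F : Lp ℂ 2 ν,
        Θ.symm ((U : H →L[ℂ] H) (Θ F)) =ᵐ[ν] fun x => Complex.exp (Complex.I * φ x) * F x) ∧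
    -- the concrete model on `𝕋 × A`, built from spectral measures of cyclic vectors
    (∃ (A : Set ℕ) (y : A → H) (ν : Measure (Circle × A)) (_ : IsFiniteMeasure ν)
      (φ : Circle × A → ℝ) (Θ : Lp ℂ 2 ν ≃ₗᵢ[ℂ] H),
      (∀ n, y n ≠ 0) ∧
      IsHilbertSum ℂ (fun n => cyclicSubspace U (y n))
        (fun n => (cyclicSubspace U (y n)).subtypeₗᵢ) ∧
      (∀ n, IsSpectralMeasure U (y n) (ν.comap fun z => (z, n))) ∧
      (∀ (n : A) (f : C(Circle, ℂ)), ∃ hf : MemLp (onComponent n f) 2 ν,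
        Θ (hf.toLp (onComponent n f)) = circleCalculus U f (y n)) ∧
      Measurable φ ∧
      (∀ p : Circle × A, Complex.exp (Complex.I * φ p) = (p.1 : ℂ)) ∧
      ∀ F : Lp ℂ 2 ν,
        Θ.symm ((U : H →L[ℂ] H) (Θ F)) =ᵐ[ν] fun p => Complex.exp (Complex.I * φ p) * F p) := by
  have hpos (n : ℕ) : (0 : ℝ) < (1 / 2) ^ n := by positivity
  obtain ⟨A, y, hnorm, hsum⟩ := exists_isHilbertSum_orbitClosure (circleCalculus U) hpos
  have hy (n : A) : y n ≠ 0 := norm_pos_iff.1 (hnorm n ▸ hpos n)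
  have hsummable : Summable fun n => ‖y n‖ ^ 2 := by
    simp only [hnorm, pow_right_comm _ _ 2]
    exact (summable_geometric_of_lt_one (by norm_num) (by norm_num)).subtype A
  obtain ⟨ν, hfin, hν⟩ :=
    exists_isFiniteMeasure_comap_isSpectralMeasureAt (circleCalculus U) hsummable
  obtain ⟨Θ, hcomponent, hmul⟩ := exists_multiplication_model hsum hν
  have hU := ae_eq_exp_arg_mul hmul
  have harg : MeasurableEmbedding (Prod.map (fun z : Circle => Complex.arg z) (id : A → A)) :=
    measurableEmbedding_arg_circle.prodMap .id
  refine ⟨⟨ℝ × A, inferInstance, inferInstance, inferInstance, inferInstance, inferInstance,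
    ν.map _, inferInstance, inferInstance, Prod.fst, (lpMapEquiv ℂ ℂ 2 harg ν).trans Θ,
    continuous_fst, ae_eq_lpMapEquiv_trans harg hU⟩, ?_⟩
  refine ⟨A, y, ν, hfin, fun p => Complex.arg p.1, Θ, hy, hsum, hν, fun n f => ?_,
    measurableEmbedding_arg_circle.measurable.comp measurable_fst,
    fun p => exp_I_mul_arg_circle p.1, hU⟩
  obtain ⟨hf, hf_eq⟩ := exists_toLp_onComponent_eq (p := 2) ν n f
  exact ⟨hf, hf_eq ▸ hcomponent n f⟩
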